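/- \textbf{Conventions.} Let $p$ be a prime and let $R$ be a Noetherian commutative ring of characteristic $p$. Let $R^\circ$ be the set of elements of $R$ that lie in no minimal prime. For $e\ge 0$ let ${}^eR$ be the $R$-module with underlying additive group $\{{}^ex : x\in R\}\cong R$ and action $r\cdot{}^ex={}^e(r^{p^e}x)$; $R$ is called $F$-finite if the Frobenius endomorphism of $R$ is module-finite. For an $R$-module $M$, the \emph{tight interior} of $M$ is \[ M_*=\bigcap_{c\in R^\circ}\ \bigcap_{e_0\ge 0}\ \sum_{e\ge e_0}\{\,g({}^ec) : g\in\operatorname{Hom}_R({}^eR,M)\,\}\subseteq M, \] and the \emph{tight closure of zero} in $M$ is \[ 0^*_M=\{\,z\in M : \text{there are } c\in R^\circ \text{ and } e_0\ge 0 \text{ with } {}^ec\otimes z=0 \text{ in } {}^eR\otimes_R M \text{ for all } e\ge e_0\,\}. \] \textbf{Proposition (Duality with tight closure).} Let $R$ be an $F$-finite reduced Noetherian ring of characteristic $p$, let $E$ be an injective $R$-module, and put $(-)'=\operatorname{Hom}_R(-,E)$. Then for every $R$-module $M$, the restriction map $M'\to (M_*)'$ is surjective with kernel $0^*_{M'}$,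 and hence induces an isomorphism of $R$-modules \[ (M_*)'\cong M'/0^*_{M'}. \] \textbf{Corollary.} Let $(R,\mathfrak m)$ be a complete reduced Noetherian local ring of characteristic $p$, let $E=E_R(R/\mathfrak m)$ be an injective hull of the residue field, and let $(-)^\vee=\operatorname{Hom}_R(-,E)$ be Matlis duality. Let $L$ be an $R$-module that is Artinian, or finitely generated, or Matlis-dualizable in the sense that the natural map $L\to L^{\vee\vee}$ is an isomorphism. Then there are isomorphisms of $R$-modules \[ (L_*)^\vee\cong L^\vee/0^*_{L^\vee}\qquad\text{and}\qquad (L^\vee)_*\cong (L/0^*_L)^\vee, \] the first induced by restricting maps $L\to E$ to $L_*$, the second by the embedding $(L/0^*_L)^\vee\hookrightarrow L^\vee$ dual to $L\twoheadrightarrow L/0^*_L$. -/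

import Mathlib

open scoped TensorProduct

universe u v w

/-- The left `R`-module `ᵉR` (also written `R^{1/q}`, `q = p ^ e`): the additive group of `R`,
with `r • x = r ^ q * x`. -/
def FrobeniusTwist (R : Type u) (_p _e : ℕ) : Type u := R

namespace FrobeniusTwist

variable (R : Type u) [CommRing R] (p : ℕ) [Fact p.Prime] [CharP R p] (e : ℕ)

instance : AddCommGroup (FrobeniusTwist R p e) :=
  inferInstanceAs (AddCommGroup R)

instance : Module R (FrobeniusTwist R p e) :=
  Module.compHom R (iterateFrobenius R p e)

/-- The element `ᵉx` of `ᵉR`. -/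
def of (x : R) : FrobeniusTwist R p e := x

theorem smul_of (r x : R) : r • of R p e x = of R p e (r ^ p ^ e * x) := rfl

/-- Multiplication by `s` on `ᵉR`, that is `ᵉx ↦ ᵉ(s x)`. -/
def mulLin (s : R) : FrobeniusTwist R p e →ₗ[R] FrobeniusTwist R p e where
  toFun x := of R p e (s * (show R from x))
  map_add' x y := mul_add s (show R from x) (show R from y)
  map_smul' r x := mul_left_comm s (iterateFrobenius R p e r) (show R from x)

theorem mulLin_of (s x : R) : mulLin R p e s (of R p e x) = of R p e (s * x) := rfl

end FrobeniusTwist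

/-- `R°`: the elements of `R` that lie in no minimal prime. -/
def minimalPrimesCompl (R : Type u) [CommRing R] : Submonoid R where
  carrier := {c | ∀ P ∈ minimalPrimes R, c ∉ P}
  one_mem' P hP h := hP.1.1.ne_top ((Ideal.eq_top_iff_one P).2 h)
  mul_mem' ha hb P hP h := (hP.1.1.mem_or_mem h).elim (ha P hP) (hb P hP)

section Operations

variable (R : Type u) [CommRing R] (p : ℕ) [Fact p.Prime] [CharP R p]
  (M : Type w) [AddCommGroup M] [Module R M]

/-- `M_*[c, p ^ e₀]`: the sum, over `e ≥ e₀`, of the images of the evaluation maps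
`Hom_R(ᵉR, M) → M`, `g ↦ g (ᵉc)`. -/
def tightInteriorAt (c : R) (e₀ : ℕ) : Submodule R M :=
  ⨆ (e : ℕ) (_ : e₀ ≤ e), LinearMap.range
    (LinearMap.applyₗ (FrobeniusTwist.of R p e c) :
      (FrobeniusTwist R p e →ₗ[R] M) →ₗ[R] M)

/-- The tight interior `M_*`. -/
def tightInterior : Submodule R M :=
  ⨅ (c : R) (_ : c ∈ minimalPrimesCompl R) (e₀ : ℕ), tightInteriorAt R p M c e₀

/-- The tight closure `0^*_M` of the zero submodule in `M`: those `z` for which there is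
`c ∈ R°` with `ᵉc ⊗ z = 0` in `ᵉR ⊗_R M` for all `e ≫ 0`. -/
def zeroTightClosure : Submodule R M where
  carrier := {z | ∃ c ∈ minimalPrimesCompl R, ∃ e₀ : ℕ, ∀ e, e₀ ≤ e →
    FrobeniusTwist.of R p e c ⊗ₜ[R] z = (0 : FrobeniusTwist R p e ⊗[R] M)}
  zero_mem' := ⟨1, one_mem _, 0, fun _ _ => TensorProduct.tmul_zero _ _⟩
  add_mem' := by
    rintro _ _ ⟨c, hc, m, hm⟩ ⟨d, hd, n, hn⟩
    refine ⟨c * d, mul_mem hc hd, max m n, fun e he => ?_⟩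
    have h1 := congrArg (LinearMap.rTensor M (FrobeniusTwist.mulLin R p e d))
      (hm e ((le_max_left _ _).trans he))
    have h2 := congrArg (LinearMap.rTensor M (FrobeniusTwist.mulLin R p e c))
      (hn e ((le_max_right _ _).trans he))
    rw [LinearMap.rTensor_tmul, FrobeniusTwist.mulLin_of, map_zero] at h1 h2
    rw [TensorProduct.tmul_add, h2, add_zero, mul_comm c d, h1]
  smul_mem' := by
    rintro r a ⟨c, hc, m, hm⟩
    exact ⟨c, hc, m, fun e he => by rw [TensorProduct.tmul_smul, hm e he, smul_zero]⟩

end Operations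

/-- `E` is an injective hull of `N` over `R`: an injective module that contains `N` (up to
isomorphism) as an essential submodule. -/
def IsInjectiveHull (R : Type u) [CommRing R] (N : Type v) [AddCommGroup N] [Module R N]
    (E : Type w) [AddCommGroup E] [Module R E] : Prop :=
  Module.Injective R E ∧ ∃ i : N →ₗ[R] E, Function.Injective i ∧
    ∀ U : Submodule R E, U ⊓ LinearMap.range i = ⊥ → U = ⊥

/-- `L` is dualizable with respect to `E`: the biduality map
`L → Hom_R(Hom_R(L, E), E)`, `x ↦ (f ↦ f x)`, is bijective. -/
def IsDualizable (R : Type u) [CommRing R] (E : Type v) [AddCommGroup E] [Module R E]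
    (L : Type w) [AddCommGroup L] [Module R L] : Prop :=
  Function.Bijective (LinearMap.applyₗ : L →ₗ[R] (L →ₗ[R] E) →ₗ[R] E)

/-!
Both parts reduce to identifying two annihilators. Restriction `M' → (M_*)'` is onto because `E` is
injective, so what has to be shown is that a functional `f : M → E` lies in `0^*_{M'}` exactly when
it kills `M_*`.

*Over an `F`-finite ring.* The module `ᵉR` is finitely presented, so `ᵉc ⊗ f` vanishes in
`ᵉR ⊗ Hom(M, E)` if and only if `f` kills every value `g(ᵉc)` of a map `g : ᵉR → M`
(`tmul_eq_zero_of_forall_apply_eq_zero`). Hence `0^*_{M'}` is the union of the annihilators of the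
submodules `tightInteriorAt R p M c e₀`. As `M_*` is the intersection of these submodules, it is
enough that it be one of them, and this is the existence of a test element: some `t ∈ R°` that, for
every `d ∈ R°`, is a value at `ᵉd` of a map `ᵉR → R` for arbitrarily large `e`
(`exists_testElement`). Its proof uses no regularity. The total ring of fractions of `R` is
semisimple, hence `¹R` becomes projective, with a finite dual basis, after inverting one
nonzerodivisor `c` (`exists_smul_id_eq_comp`), and then so do all `ᵉR`
(`FrobeniusTwist.exists_hasDualBasisUpTo`). In `R_c` the ideals of values at `ᵉd` increase with `e`,
and Krull's intersection theorem shows that they reach the unit ideal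
(`exists_pow_mem_valueIdeal`). Composing with a map `ᵐR → R` that sends `ᵐ1` to a fixed power of `c`
makes the power of `c` obtained in this way independent of `d`.

*Over a complete local ring.* Artinian and finitely generated modules are dualizable (Matlis
duality), so `L` may be assumed dualizable. By adjunction the values at `ᵉc` of maps `ᵉR → L^∨` are
the functionals that kill the kernel of `x ↦ ᵉc ⊗ x`, and a submodule of `L^∨` equals its double
annihilator. Therefore `(L^∨)_*` is the annihilator of `0^*_L`
(`IsDualizable.mem_tightInterior_dual_iff`), which is the second isomorphism. The first follows by
applying this to `L^∨`, whose dual is `L`, and taking a double annihilator once more; test elements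
do not enter.
-/

/-! ### Modules that are dualizable with respect to an injective module -/

/-- A linear map into an injective module `E` factors through `π` as soon as it kills the kernel
of `π`; the map `π` need not be surjective. -/
theorem Module.Injective.exists_comp_eq_of_ker_le {R : Type u} [CommRing R]
    {E : Type (max u v)} [AddCommGroup E] [Module R E] (hE : Module.Injective R E)
    {A B : Type*} [AddCommGroup A] [Module R A] [AddCommGroup B] [Module R B]
    (π : A →ₗ[R] B) (f : A →ₗ[R] E) (h : LinearMap.ker π ≤ LinearMap.ker f) :
    ∃ g : B →ₗ[R] E, g ∘ₗ π = f := by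
  obtain ⟨g, hg⟩ := Module.Injective.extension_property R E (A ⧸ LinearMap.ker π) B
    ((LinearMap.ker π).liftQ π le_rfl)
    (LinearMap.ker_eq_bot.1 (Submodule.ker_liftQ_eq_bot _ _ _ le_rfl))
    ((LinearMap.ker π).liftQ f h)
  exact ⟨g, LinearMap.ext fun x => LinearMap.congr_fun hg (Submodule.Quotient.mk x)⟩

section Cogenerator

variable {R : Type u} [CommRing R] [IsLocalRing R]
  {E : Type (max u v)} [AddCommGroup E] [Module R E]

/-- The injective hull of the residue field is a cogenerator: functionals separate points. -/
theorem IsInjectiveHull.exists_dual_apply_ne_zero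
    (hE : IsInjectiveHull R (IsLocalRing.ResidueField R) E)
    {X : Type*} [AddCommGroup X] [Module R X] {x : X} (hx : x ≠ 0) :
    ∃ f : X →ₗ[R] E, f x ≠ 0 := by
  obtain ⟨hinj, i, hi, -⟩ := hE
  have hle : LinearMap.ker (LinearMap.toSpanSingleton R X x) ≤
      LinearMap.ker (i ∘ₗ Algebra.linearMap R (IsLocalRing.ResidueField R)) := by
    intro r hr
    have hr' : r ∈ IsLocalRing.maximalIdeal R := by
      refine IsLocalRing.le_maximalIdeal (fun h => hx ?_) hr
      have h1 : (1 : R) ∈ LinearMap.ker (LinearMap.toSpanSingleton R X x) := by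
        rw [h]; trivial
      simpa using h1
    rw [LinearMap.mem_ker, LinearMap.comp_apply, Algebra.linearMap_apply,
      IsLocalRing.ResidueField.algebraMap_eq, (IsLocalRing.residue_eq_zero_iff r).2 hr', map_zero]
  obtain ⟨g, hg⟩ := hinj.exists_comp_eq_of_ker_le _ _ hle
  refine ⟨g, fun h => ?_⟩
  have h1 := LinearMap.congr_fun hg 1
  rw [LinearMap.comp_apply, LinearMap.comp_apply, LinearMap.toSpanSingleton_apply, one_smul, h,
    Algebra.linearMap_apply, map_one] at h1
  exact one_ne_zero (hi (h1.symm.trans (map_zero i).symm))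

theorem IsInjectiveHull.exists_dual_of_notMem
    (hE : IsInjectiveHull R (IsLocalRing.ResidueField R) E)
    {X : Type*} [AddCommGroup X] [Module R X] (V : Submodule R X) {x : X} (hx : x ∉ V) :
    ∃ f : X →ₗ[R] E, (∀ y ∈ V, f y = 0) ∧ f x ≠ 0 := by
  obtain ⟨f, hf⟩ := hE.exists_dual_apply_ne_zero (x := V.mkQ x)
    (fun h => hx ((Submodule.Quotient.mk_eq_zero V).1 h))
  refine ⟨f ∘ₗ V.mkQ, fun y hy => ?_, hf⟩
  rw [LinearMap.comp_apply, Submodule.mkQ_apply, (Submodule.Quotient.mk_eq_zero V).2 hy, map_zero]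

theorem IsInjectiveHull.isDualizable_iff
    (hE : IsInjectiveHull R (IsLocalRing.ResidueField R) E)
    {X : Type*} [AddCommGroup X] [Module R X] :
    IsDualizable R E X ↔ ∀ α : (X →ₗ[R] E) →ₗ[R] E, ∃ x : X, ∀ f, α f = f x := by
  constructor
  · intro h α
    obtain ⟨x, rfl⟩ := h.2 α
    exact ⟨x, fun f => rfl⟩
  · refine fun h => ⟨?_, fun α => ?_⟩
    · refine (injective_iff_map_eq_zero _).2 fun x hx => ?_
      by_contra hne
      obtain ⟨f, hf⟩ := hE.exists_dual_apply_ne_zero hne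
      exact hf (LinearMap.congr_fun hx f)
    · obtain ⟨x, hx⟩ := h α
      exact ⟨x, LinearMap.ext fun f => (hx f).symm⟩

theorem IsDualizable.of_surjective (hE : IsInjectiveHull R (IsLocalRing.ResidueField R) E)
    {B C : Type*} [AddCommGroup B] [Module R B] [AddCommGroup C] [Module R C]
    (hB : IsDualizable R E B) (π : B →ₗ[R] C) (hπ : Function.Surjective π) :
    IsDualizable R E C := by
  rw [hE.isDualizable_iff] at hB ⊢
  intro α
  obtain ⟨β, hβ⟩ := hE.1.exists_comp_eq_of_ker_le (LinearMap.lcomp R E π) α (by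
    rw [LinearMap.ker_eq_bot.2 (LinearMap.lcomp_injective_of_surjective π hπ)]
    exact bot_le)
  obtain ⟨b, hb⟩ := hB β
  refine ⟨π b, fun f => ?_⟩
  rw [← hβ, LinearMap.comp_apply, hb]
  rfl

theorem IsDualizable.of_injective (hE : IsInjectiveHull R (IsLocalRing.ResidueField R) E)
    {A B : Type*} [AddCommGroup A] [Module R A] [AddCommGroup B] [Module R B]
    (hB : IsDualizable R E B) (i : A →ₗ[R] B) (hi : Function.Injective i) :
    IsDualizable R E A := by
  rw [hE.isDualizable_iff] at hB ⊢
  intro α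
  obtain ⟨b, hb⟩ := hB (α ∘ₗ LinearMap.lcomp R E i)
  have hmem : b ∈ LinearMap.range i := by
    by_contra hne
    obtain ⟨f, hf, hfb⟩ := hE.exists_dual_of_notMem _ hne
    refine hfb ?_
    have : LinearMap.lcomp R E i f = 0 := LinearMap.ext fun a => hf _ ⟨a, rfl⟩
    rw [← hb, LinearMap.comp_apply, this, map_zero]
  obtain ⟨a, rfl⟩ := hmem
  refine ⟨a, fun f => ?_⟩
  obtain ⟨g, rfl⟩ := hE.1.exists_comp_eq_of_ker_le i f (by
    rw [LinearMap.ker_eq_bot.2 hi]; exact bot_le)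
  exact hb g

/-- Dualizable modules are closed under extensions. -/
theorem IsDualizable.of_quotient (hE : IsInjectiveHull R (IsLocalRing.ResidueField R) E)
    {B : Type*} [AddCommGroup B] [Module R B] (N : Submodule R B)
    (hN : IsDualizable R E N) (hQ : IsDualizable R E (B ⧸ N)) : IsDualizable R E B := by
  rw [hE.isDualizable_iff] at hN hQ ⊢
  intro β
  obtain ⟨c, hc⟩ := hQ (β ∘ₗ LinearMap.lcomp R E N.mkQ)
  obtain ⟨b, rfl⟩ := N.mkQ_surjective c
  -- `β` agrees with evaluation at `b` on the functionals that kill `N`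
  obtain ⟨α, hα⟩ := hE.1.exists_comp_eq_of_ker_le (LinearMap.lcomp R E N.subtype)
    (β - LinearMap.applyₗ b) (by
      intro f hf
      obtain ⟨g, rfl⟩ : ∃ g : B ⧸ N →ₗ[R] E, g ∘ₗ N.mkQ = f :=
        ⟨N.liftQ f fun x hx => LinearMap.congr_fun hf ⟨x, hx⟩, N.liftQ_mkQ f _⟩
      rw [LinearMap.mem_ker, LinearMap.sub_apply, sub_eq_zero]
      exact hc g)
  obtain ⟨a, ha⟩ := hN α
  refine ⟨b + a, fun f => ?_⟩
  have h := LinearMap.congr_fun hα f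
  rw [LinearMap.comp_apply, ha, LinearMap.sub_apply, eq_sub_iff_add_eq] at h
  rw [← h, map_add, add_comm]
  rfl

theorem IsDualizable.pi (hE : IsInjectiveHull R (IsLocalRing.ResidueField R) E)
    {B : Type*} [AddCommGroup B] [Module R B] (hB : IsDualizable R E B)
    {ι : Type*} [Finite ι] : IsDualizable R E (ι → B) := by
  classical
  cases nonempty_fintype ι
  rw [hE.isDualizable_iff] at hB ⊢
  intro α
  choose b hb using fun i : ι => hB (α ∘ₗ LinearMap.lcomp R E (LinearMap.proj i))
  refine ⟨b, fun f => ?_⟩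
  have hf : f = ∑ i, LinearMap.lcomp R E (LinearMap.proj i)
      (f ∘ₗ LinearMap.single R (fun _ : ι => B) i) := by
    refine LinearMap.ext fun x => ?_
    rw [LinearMap.sum_apply]
    conv_lhs => rw [← Finset.univ_sum_single x, map_sum]
    rfl
  have h1 : ∀ i, α (LinearMap.lcomp R E (LinearMap.proj i)
      (f ∘ₗ LinearMap.single R (fun _ : ι => B) i)) = f (Pi.single i (b i)) := fun i => hb i _
  conv_lhs => rw [hf]
  rw [map_sum, Finset.sum_congr rfl fun i _ => h1 i, ← map_sum, Finset.univ_sum_single]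

/-- The socle of an essential extension of the residue field is the residue field. -/
theorem IsInjectiveHull.mem_range_of_maximalIdeal_smul
    {i : IsLocalRing.ResidueField R →ₗ[R] E}
    (hess : ∀ U : Submodule R E, U ⊓ LinearMap.range i = ⊥ → U = ⊥) {e : E}
    (he : ∀ r ∈ IsLocalRing.maximalIdeal R, r • e = 0) : e ∈ LinearMap.range i := by
  by_cases h : R ∙ e = ⊥
  · rw [Submodule.span_singleton_eq_bot] at h
    exact h ▸ zero_mem _
  obtain ⟨y, ⟨hy1, hy2⟩, hy0⟩ := (Submodule.ne_bot_iff _).1 fun h0 => h (hess _ h0)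
  obtain ⟨r, rfl⟩ := Submodule.mem_span_singleton.1 hy1
  have hr : IsUnit r := by
    by_contra hr
    exact hy0 (he r hr)
  obtain ⟨s, rfl⟩ := hr
  have := (LinearMap.range i).smul_mem (↑s⁻¹ : R) hy2
  rwa [smul_smul, Units.inv_mul, one_smul] at this

theorem IsInjectiveHull.isDualizable_residueField
    (hE : IsInjectiveHull R (IsLocalRing.ResidueField R) E) :
    IsDualizable R E (IsLocalRing.ResidueField R) := by
  rw [hE.isDualizable_iff]
  obtain ⟨hinj, i, hi, hess⟩ := hE
  have hkill : ∀ r ∈ IsLocalRing.maximalIdeal R, ∀ x : IsLocalRing.ResidueField R,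
      r • x = 0 := fun r hr x => by
    rw [Algebra.smul_def, IsLocalRing.ResidueField.algebraMap_eq,
      (IsLocalRing.residue_eq_zero_iff r).2 hr, zero_mul]
  intro α
  obtain ⟨a, ha⟩ := IsInjectiveHull.mem_range_of_maximalIdeal_smul hess (e := α i) fun r hr => by
    have : r • i = 0 := LinearMap.ext fun x => by
      rw [LinearMap.smul_apply, ← map_smul, hkill r hr, map_zero, LinearMap.zero_apply]
    rw [← map_smul, this, map_zero]
  refine ⟨a, fun f => ?_⟩
  -- the socle of `E` is the residue field, so every functional is a multiple of `i`
  obtain ⟨t, ht⟩ := IsInjectiveHull.mem_range_of_maximalIdeal_smul hess (e := f 1) fun r hr => by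
    rw [← map_smul, hkill r hr, map_zero]
  obtain ⟨r, rfl⟩ := IsLocalRing.residue_surjective t
  have hf : f = r • i := by
    refine LinearMap.ext fun x => ?_
    obtain ⟨s, rfl⟩ := IsLocalRing.residue_surjective x
    have h1 : IsLocalRing.residue R s = s • (1 : IsLocalRing.ResidueField R) := by
      rw [Algebra.smul_def, mul_one]; rfl
    have h2 : IsLocalRing.residue R r = r • (1 : IsLocalRing.ResidueField R) := by
      rw [Algebra.smul_def, mul_one]; rfl
    rw [h1, map_smul, ← ht, h2, map_smul, map_smul, LinearMap.smul_apply]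
  rw [hf, map_smul, LinearMap.smul_apply, ha]

theorem IsInjectiveHull.isDualizable_of_isFiniteLength
    (hE : IsInjectiveHull R (IsLocalRing.ResidueField R) E)
    {X : Type*} [AddCommGroup X] [Module R X] (hX : IsFiniteLength R X) :
    IsDualizable R E X := by
  induction hX with
  | of_subsingleton =>
    exact hE.isDualizable_iff.2 fun α => ⟨0, fun f => by
      rw [Subsingleton.elim f 0, map_zero, map_zero]⟩
  | @of_simple_quotient M _ _ N hs _ ih =>
    refine IsDualizable.of_quotient hE N ih ?_
    obtain ⟨I, hI, ⟨e⟩⟩ := isSimpleModule_iff_quot_maximal.1 hs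
    obtain rfl := IsLocalRing.eq_maximalIdeal hI
    exact hE.isDualizable_residueField.of_surjective hE e.symm.toLinearMap e.symm.surjective

end Cogenerator

/-! ### Matlis duality over a complete Noetherian local ring -/

section Matlis

variable {R : Type u} [CommRing R] [IsLocalRing R]
  {E : Type (max u v)} [AddCommGroup E] [Module R E]

open IsLocalRing

/-- By Krull's intersection theorem some `m ^ n • (R ∙ x)` misses the residue field inside `E`, so
it vanishes because `E` is an essential extension. -/
theorem IsInjectiveHull.exists_pow_smul_eq_zero [IsNoetherianRing R]
    (hE : IsInjectiveHull R (ResidueField R) E) (x : E) :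
    ∃ n : ℕ, ∀ r ∈ maximalIdeal R ^ n, r • x = 0 := by
  obtain ⟨-, i, hi, hess⟩ := hE
  let X : Submodule R E := R ∙ x
  let F : ℕ → Submodule R E := fun n => maximalIdeal R ^ n • X
  have hF : ⨅ n, F n = ⊥ := by
    have h := Ideal.iInf_pow_smul_eq_bot_of_isLocalRing (M := X) (maximalIdeal R)
      (maximalIdeal.isMaximal R).ne_top
    have h2 : ∀ n, F n = (maximalIdeal R ^ n • (⊤ : Submodule R X)).map X.subtype := fun n => by
      rw [Submodule.map_smul'', Submodule.map_top, Submodule.range_subtype]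
    rw [iInf_congr h2, ← Submodule.map_iInf _ X.injective_subtype, h, Submodule.map_bot]
  obtain ⟨n, hn⟩ : ∃ n, F n ⊓ LinearMap.range i = ⊥ := by
    -- `i 1` spans the range of `i`, and it misses some `F n`
    have hne : i 1 ≠ 0 := fun h => one_ne_zero (hi (h.trans (map_zero i).symm))
    obtain ⟨n, hn⟩ : ∃ n, i 1 ∉ F n := by
      by_contra! hall
      exact hne ((Submodule.mem_bot R).1 (hF ▸ (Submodule.mem_iInf _).2 hall))
    refine ⟨n, (Submodule.eq_bot_iff _).2 ?_⟩
    rintro _ ⟨h1, t, rfl⟩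
    by_contra ht
    have ht0 : t ≠ 0 := fun h => ht (by rw [h, map_zero])
    obtain ⟨r, hr⟩ := residue_surjective t⁻¹
    refine hn ?_
    have h3 : (1 : ResidueField R) = r • t := by
      rw [Algebra.smul_def, ResidueField.algebraMap_eq, hr, inv_mul_cancel₀ ht0]
    rw [h3, map_smul]
    exact (F n).smul_mem r h1
  refine ⟨n, fun r hr => ?_⟩
  have : r • x ∈ F n := Submodule.smul_mem_smul hr (Submodule.mem_span_singleton_self x)
  rwa [hess _ hn] at this

theorem isFiniteLength_quotient_maximalIdeal_pow [IsNoetherianRing R] (n : ℕ) :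
    IsFiniteLength R (R ⧸ maximalIdeal R ^ n) := by
  have hart : IsArtinianRing (R ⧸ maximalIdeal R ^ n) := by
    rcases Nat.eq_zero_or_pos n with rfl | hn
    · have : Subsingleton (R ⧸ maximalIdeal R ^ 0) :=
        Ideal.Quotient.subsingleton_iff.2 (by rw [pow_zero, Ideal.one_eq_top])
      infer_instance
    have hle : maximalIdeal R ^ n ≤ maximalIdeal R := Ideal.pow_le_self hn.ne'
    have : Nontrivial (R ⧸ maximalIdeal R ^ n) := Ideal.Quotient.nontrivial_iff.2
      fun h => (maximalIdeal.isMaximal R).ne_top (top_le_iff.1 (h ▸ hle))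
    have : IsLocalRing (R ⧸ maximalIdeal R ^ n) :=
      IsLocalRing.of_surjective' (Ideal.Quotient.mk _) Ideal.Quotient.mk_surjective
    rw [isArtinianRing_iff_isNilpotent_maximalIdeal]
    refine ⟨n, ?_⟩
    have h1 : maximalIdeal (R ⧸ maximalIdeal R ^ n) =
        (maximalIdeal R).map (Ideal.Quotient.mk (maximalIdeal R ^ n)) := by
      refine (IsLocalRing.eq_maximalIdeal ?_).symm
      refine Ideal.IsMaximal.map_of_surjective_of_ker_le Ideal.Quotient.mk_surjective ?_
      rwa [Ideal.mk_ker]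
    rw [h1, ← Ideal.map_pow, Ideal.map_quotient_self]
    rfl
  have hart' : IsArtinian (R ⧸ maximalIdeal R ^ n) (R ⧸ maximalIdeal R ^ n) := hart
  have h2 : IsArtinian R (R ⧸ maximalIdeal R ^ n) :=
    isArtinian_of_surjective_algebraMap (R := R ⧸ maximalIdeal R ^ n) (S := R)
      Ideal.Quotient.mk_surjective
  exact isFiniteLength_iff_isNoetherian_isArtinian.2 ⟨inferInstance, h2⟩

/-- A double functional on a complete local ring `R` is, on each `(R ⧸ m ^ n)^∨ ⊆ R^∨`, evaluation
at some `r n`; the `r n` form a Cauchy sequence, and the functional is evaluation at its limit. -/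
theorem IsInjectiveHull.isDualizable_self [IsNoetherianRing R]
    [IsAdicComplete (maximalIdeal R) R]
    (hE : IsInjectiveHull R (ResidueField R) E) : IsDualizable R E R := by
  rw [hE.isDualizable_iff]
  intro α
  have hex : ∀ n, ∃ r : R, ∀ f : R →ₗ[R] E, (∀ s ∈ maximalIdeal R ^ n, f s = 0) →
      α f = f r := fun n => by
    obtain ⟨c, hc⟩ := hE.isDualizable_iff.1
      (hE.isDualizable_of_isFiniteLength (isFiniteLength_quotient_maximalIdeal_pow n))
      (α ∘ₗ LinearMap.lcomp R E (Submodule.mkQ (maximalIdeal R ^ n)))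
    obtain ⟨r, rfl⟩ := Submodule.mkQ_surjective _ c
    refine ⟨r, fun f hf => ?_⟩
    have hker : maximalIdeal R ^ n ≤ LinearMap.ker f := hf
    have := hc (Submodule.liftQ (maximalIdeal R ^ n) f hker)
    rwa [LinearMap.comp_apply, LinearMap.lcomp_apply', Submodule.liftQ_mkQ,
      Submodule.mkQ_apply, Submodule.liftQ_apply] at this
  choose r hr using hex
  have hcauchy : ∀ {m n : ℕ}, m ≤ n →
      r m ≡ r n [SMOD (maximalIdeal R ^ m • ⊤ : Submodule R R)] := fun {m n} hmn => by
    rw [SModEq.sub_mem, smul_eq_mul, Ideal.mul_top]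
    by_contra hne
    obtain ⟨f, hf, hne⟩ := hE.exists_dual_of_notMem _ hne
    refine hne ?_
    rw [map_sub, ← hr m f hf, ← hr n f fun s hs => hf s (Ideal.pow_le_pow_right hmn hs), sub_self]
  obtain ⟨l, hl⟩ := IsPrecomplete.prec' (I := maximalIdeal R) r hcauchy
  refine ⟨l, fun f => ?_⟩
  obtain ⟨n, hn⟩ := hE.exists_pow_smul_eq_zero (f 1)
  have hf : ∀ s ∈ maximalIdeal R ^ n, f s = 0 := fun s hs => by
    rw [← hn s hs, ← map_smul, smul_eq_mul, mul_one]
  have h1 := hl n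
  rw [SModEq.sub_mem, smul_eq_mul, Ideal.mul_top] at h1
  rw [hr n f hf, ← sub_eq_zero, ← map_sub, hf _ h1]

theorem IsInjectiveHull.isDualizable_injectiveHull [IsNoetherianRing R]
    [IsAdicComplete (maximalIdeal R) R]
    (hE : IsInjectiveHull R (ResidueField R) E) : IsDualizable R E E := by
  rw [hE.isDualizable_iff]
  intro α
  refine ⟨α LinearMap.id, fun h => ?_⟩
  -- every endomorphism of `E` is a homothety, because `R` is dualizable
  obtain ⟨r, hr⟩ := hE.isDualizable_iff.1 hE.isDualizable_self
    (h ∘ₗ LinearMap.applyₗ (1 : R))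
  have h1 : h = r • LinearMap.id := LinearMap.ext fun e => by
    have := hr (LinearMap.toSpanSingleton R E e)
    simpa using this
  rw [h1, map_smul, LinearMap.smul_apply, LinearMap.id_apply]

theorem IsInjectiveHull.isDualizable_of_finite [IsNoetherianRing R]
    [IsAdicComplete (maximalIdeal R) R]
    (hE : IsInjectiveHull R (ResidueField R) E)
    {L : Type*} [AddCommGroup L] [Module R L] [Module.Finite R L] : IsDualizable R E L := by
  obtain ⟨n, π, hπ⟩ := Module.Finite.exists_fin' R L
  exact (hE.isDualizable_self.pi hE).of_surjective hE π hπ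

/-- An Artinian module embeds in a finite power of the injective hull. -/
theorem IsInjectiveHull.isDualizable_of_isArtinian [IsNoetherianRing R]
    [IsAdicComplete (maximalIdeal R) R]
    (hE : IsInjectiveHull R (ResidueField R) E)
    {L : Type*} [AddCommGroup L] [Module R L] [IsArtinian R L] : IsDualizable R E L := by
  classical
  let K : Finset (L →ₗ[R] E) → Submodule R L := fun s => ⨅ f ∈ s, LinearMap.ker f
  obtain ⟨_, ⟨s, rfl⟩, hmin⟩ := IsArtinian.set_has_minimal (Set.range K) ⟨_, ⟨∅, rfl⟩⟩
  have hK : K s = ⊥ := by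
    refine (Submodule.eq_bot_iff _).2 fun x hx => ?_
    by_contra hne
    obtain ⟨f, hf⟩ := hE.exists_dual_apply_ne_zero hne
    refine hmin _ ⟨insert f s, rfl⟩ (lt_of_le_of_ne ?_ fun h => ?_)
    · exact iInf_le_iInf_of_subset fun g hg => Finset.mem_insert_of_mem hg
    · have h1 : x ∈ K (insert f s) := h ▸ hx
      simp only [K, Submodule.mem_iInf] at h1
      exact hf (h1 f (Finset.mem_insert_self f s))
  refine (hE.isDualizable_injectiveHull.pi hE (ι := s)).of_injective hE
    (LinearMap.pi fun f : s => (f : L →ₗ[R] E)) (LinearMap.ker_eq_bot.1 ?_)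
  rw [LinearMap.ker_pi, ← hK]
  exact iInf_subtype

end Matlis

/-! ### Tight interior as an annihilator -/

section Interior

variable {R : Type u} [CommRing R] {p : ℕ} [Fact p.Prime] [CharP R p]
  {E : Type (max u v)} [AddCommGroup E] [Module R E]

theorem apply_mem_tightInteriorAt {M : Type*} [AddCommGroup M] [Module R M] {c : R} {e₀ e : ℕ}
    (he : e₀ ≤ e) (g : FrobeniusTwist R p e →ₗ[R] M) :
    g (FrobeniusTwist.of R p e c) ∈ tightInteriorAt R p M c e₀ :=
  Submodule.mem_iSup_of_mem e (Submodule.mem_iSup_of_mem he ⟨g, rfl⟩)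

theorem tightInteriorAt_le_iff {M : Type*} [AddCommGroup M] [Module R M] {c : R} {e₀ : ℕ}
    {V : Submodule R M} : tightInteriorAt R p M c e₀ ≤ V ↔
      ∀ e, e₀ ≤ e → ∀ g : FrobeniusTwist R p e →ₗ[R] M, g (FrobeniusTwist.of R p e c) ∈ V := by
  refine ⟨fun h e he g => h (apply_mem_tightInteriorAt he g), fun h => iSup₂_le fun e he => ?_⟩
  rintro _ ⟨g, rfl⟩
  exact h e he g

theorem mem_tightInterior {M : Type*} [AddCommGroup M] [Module R M] {x : M} :
    x ∈ tightInterior R p M ↔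
      ∀ c ∈ minimalPrimesCompl R, ∀ e₀, x ∈ tightInteriorAt R p M c e₀ := by
  simp only [tightInterior, Submodule.mem_iInf]

theorem map_mem_tightInterior {M N : Type*} [AddCommGroup M] [Module R M] [AddCommGroup N]
    [Module R N] (h : M →ₗ[R] N) {x : M} (hx : x ∈ tightInterior R p M) :
    h x ∈ tightInterior R p N := by
  rw [mem_tightInterior] at hx ⊢
  intro c hc e₀
  have hle : tightInteriorAt R p M c e₀ ≤ (tightInteriorAt R p N c e₀).comap h :=
    tightInteriorAt_le_iff.2 fun e he g => apply_mem_tightInteriorAt he (h ∘ₗ g)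
  exact hle (hx c hc e₀)

/-- Restriction to `M_*` is surjective because `E` is injective, so the duality isomorphism comes
down to identifying its kernel. -/
theorem exists_quotient_zeroTightClosure_equiv (hE : Module.Injective R E)
    {M : Type*} [AddCommGroup M] [Module R M]
    (h : ∀ f : M →ₗ[R] E, f ∈ zeroTightClosure R p (M →ₗ[R] E) ↔
      ∀ x ∈ tightInterior R p M, f x = 0) :
    ∃ φ : ((M →ₗ[R] E) ⧸ zeroTightClosure R p (M →ₗ[R] E)) ≃ₗ[R]
        (tightInterior R p M →ₗ[R] E),
      ∀ (f : M →ₗ[R] E) (x : tightInterior R p M), φ (Submodule.Quotient.mk f) x = f x := by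
  let ρ := LinearMap.lcomp R E (tightInterior R p M).subtype
  have hρ : Function.Surjective ρ := fun f =>
    hE.exists_comp_eq_of_ker_le (tightInterior R p M).subtype f (by
      rw [Submodule.ker_subtype]; exact bot_le)
  have hker : zeroTightClosure R p (M →ₗ[R] E) = LinearMap.ker ρ := by
    ext f
    rw [h, LinearMap.mem_ker]
    exact ⟨fun hf => LinearMap.ext fun x => hf x x.2, fun hf x hx => LinearMap.congr_fun hf ⟨x, hx⟩⟩
  exact ⟨(Submodule.quotEquivOfEq _ _ hker).trans (ρ.quotKerEquivOfSurjective hρ),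
    fun f x => rfl⟩

/-- Adjunction between `⊗` and `Hom`: a functional on `L` is the value at `n` of a linear map
`N → L^∨` exactly when it factors through `x ↦ n ⊗ x`. -/
theorem mem_range_applyₗ_dual_iff (hE : Module.Injective R E)
    {L N : Type*} [AddCommGroup L] [Module R L] [AddCommGroup N] [Module R N] (n : N)
    (φ : L →ₗ[R] E) :
    φ ∈ LinearMap.range (LinearMap.applyₗ n : (N →ₗ[R] (L →ₗ[R] E)) →ₗ[R] (L →ₗ[R] E)) ↔
      ∀ x, n ⊗ₜ[R] x = (0 : N ⊗[R] L) → φ x = 0 := by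
  constructor
  · rintro ⟨g, rfl⟩ x hx
    have := congrArg (TensorProduct.lift g) hx
    rwa [TensorProduct.lift.tmul, map_zero] at this
  · intro h
    obtain ⟨g, hg⟩ := hE.exists_comp_eq_of_ker_le (TensorProduct.mk R N L n) φ fun x hx => h x hx
    exact ⟨TensorProduct.curry g, LinearMap.ext fun x => LinearMap.congr_fun hg x⟩

section Local

variable [IsLocalRing R]

/-- Double annihilator property: a submodule `V` of the dual of a dualizable module `L` contains
every functional that vanishes on the annihilator of `V` in `L`. -/
theorem IsDualizable.mem_of_forall_apply_eq_zero
    (hE : IsInjectiveHull R (IsLocalRing.ResidueField R) E)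
    {L : Type*} [AddCommGroup L] [Module R L] (hL : IsDualizable R E L)
    {V : Submodule R (L →ₗ[R] E)} {φ : L →ₗ[R] E}
    (h : ∀ x, (∀ f ∈ V, f x = 0) → φ x = 0) : φ ∈ V := by
  by_contra hne
  obtain ⟨α, hα, hne⟩ := hE.exists_dual_of_notMem V hne
  obtain ⟨x, hx⟩ := hE.isDualizable_iff.1 hL α
  rw [hx] at hne
  exact hne (h x fun f hf => (hx f).symm.trans (hα f hf))

theorem IsDualizable.dual (hE : IsInjectiveHull R (IsLocalRing.ResidueField R) E)
    {L : Type*} [AddCommGroup L] [Module R L] (hL : IsDualizable R E L) :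
    IsDualizable R E (L →ₗ[R] E) := by
  refine hE.isDualizable_iff.2 fun α => ⟨α ∘ₗ LinearMap.applyₗ, fun β => ?_⟩
  obtain ⟨x, rfl⟩ := hL.2 β
  rfl

/-- `(L^∨)_*` is the annihilator of `0^*_L`: for fixed `c` and `e₀`, the sum of the annihilators of
the kernels of `x ↦ ᵉc ⊗ x`, `e ≥ e₀`, is the annihilator of the intersection of these kernels. -/
theorem IsDualizable.mem_tightInterior_dual_iff
    (hE : IsInjectiveHull R (IsLocalRing.ResidueField R) E)
    {L : Type*} [AddCommGroup L] [Module R L] (hL : IsDualizable R E L) (φ : L →ₗ[R] E) :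
    φ ∈ tightInterior R p (L →ₗ[R] E) ↔ ∀ x ∈ zeroTightClosure R p L, φ x = 0 := by
  rw [mem_tightInterior]
  constructor
  · rintro h x ⟨c, hc, e₀, hx⟩
    have hle : tightInteriorAt R p (L →ₗ[R] E) c e₀ ≤
        LinearMap.ker (LinearMap.applyₗ x : (L →ₗ[R] E) →ₗ[R] E) :=
      tightInteriorAt_le_iff.2 fun e he g =>
        (mem_range_applyₗ_dual_iff hE.1 _ _).1 ⟨g, rfl⟩ x (hx e he)
    exact hle (h c hc e₀)
  · intro h c hc e₀
    refine hL.mem_of_forall_apply_eq_zero hE fun x hx => h x ⟨c, hc, e₀, fun e he => ?_⟩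
    by_contra hne
    obtain ⟨g, hg⟩ := hE.exists_dual_apply_ne_zero hne
    exact hg (hx _ (apply_mem_tightInteriorAt he (TensorProduct.curry g)))

theorem IsDualizable.mem_zeroTightClosure_dual_iff
    (hE : IsInjectiveHull R (IsLocalRing.ResidueField R) E)
    {L : Type*} [AddCommGroup L] [Module R L] (hL : IsDualizable R E L) (f : L →ₗ[R] E) :
    f ∈ zeroTightClosure R p (L →ₗ[R] E) ↔ ∀ x ∈ tightInterior R p L, f x = 0 := by
  -- `L` is the dual of `L^∨`, so `L_*` is the annihilator of `0^*` in `L^∨`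
  have hmem : ∀ x : L, x ∈ tightInterior R p L ↔
      ∀ f ∈ zeroTightClosure R p (L →ₗ[R] E), f x = 0 := fun x => by
    refine Iff.trans ⟨fun h => ?_, fun h => ?_⟩
      ((hL.dual hE).mem_tightInterior_dual_iff hE (LinearMap.applyₗ x))
    · exact map_mem_tightInterior _ h
    · let e := LinearEquiv.ofBijective (LinearMap.applyₗ : L →ₗ[R] (L →ₗ[R] E) →ₗ[R] E) hL
      have := map_mem_tightInterior e.symm.toLinearMap h
      rwa [show LinearMap.applyₗ x = e x from rfl, LinearEquiv.coe_coe,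
        LinearEquiv.symm_apply_apply] at this
  refine ⟨fun hf x hx => (hmem x).1 hx f hf, fun h => ?_⟩
  exact hL.mem_of_forall_apply_eq_zero hE fun x hx => h x ((hmem x).2 hx)

theorem IsDualizable.exists_tightInterior_dual_equiv
    (hE : IsInjectiveHull R (IsLocalRing.ResidueField R) E)
    {L : Type*} [AddCommGroup L] [Module R L] (hL : IsDualizable R E L) :
    ∃ ψ : tightInterior R p (L →ₗ[R] E) ≃ₗ[R] ((L ⧸ zeroTightClosure R p L) →ₗ[R] E),
      ∀ (g : tightInterior R p (L →ₗ[R] E)) (x : L),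
        ψ g (Submodule.Quotient.mk x) = (g : L →ₗ[R] E) x := by
  let T := zeroTightClosure R p L
  let ι : ((L ⧸ T) →ₗ[R] E) →ₗ[R] tightInterior R p (L →ₗ[R] E) :=
    (LinearMap.lcomp R E T.mkQ).codRestrict _ fun f =>
      (hL.mem_tightInterior_dual_iff hE _).2 fun x hx => by
        rw [LinearMap.lcomp_apply, Submodule.mkQ_apply, (Submodule.Quotient.mk_eq_zero T).2 hx,
          map_zero]
  have hι : Function.Bijective ι := by
    constructor
    · intro f g hfg
      exact LinearMap.lcomp_injective_of_surjective T.mkQ T.mkQ_surjective (congrArg Subtype.val hfg)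
    · rintro ⟨f, hf⟩
      have hle : T ≤ LinearMap.ker f := (hL.mem_tightInterior_dual_iff hE f).1 hf
      exact ⟨T.liftQ f hle, Subtype.ext (T.liftQ_mkQ f hle)⟩
  refine ⟨(LinearEquiv.ofBijective ι hι).symm, fun g x => ?_⟩
  obtain ⟨f, rfl⟩ := (LinearEquiv.ofBijective ι hι).surjective g
  rw [LinearEquiv.symm_apply_apply]
  rfl

end Local

end Interior

/-! ### Generic projectivity over a reduced Noetherian ring -/

section Generic

/-- In a reduced ring the union of the minimal primes is the set of zero divisors. -/
theorem mem_minimalPrimesCompl_iff {R : Type u} [CommRing R] [IsReduced R] {c : R} :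
    c ∈ minimalPrimesCompl R ↔ c ∈ nonZeroDivisors R := by
  refine ⟨fun hc => mem_nonZeroDivisors_iff_right.2 fun y hy => ?_, fun hc P hP hcP =>
    notMem_nonZeroDivisors_of_mem_mem_minimalPrimes hcP hP hc⟩
  have h : y ∈ sInf (minimalPrimes R) := Ideal.mem_sInf.2 fun {P} hP =>
    (hP.1.1.mem_or_mem (hy.symm ▸ P.zero_mem : y * c ∈ P)).resolve_right (hc P hP)
  have h2 : sInf (minimalPrimes R) = ⊥ := by
    rw [minimalPrimes, Ideal.sInf_minimalPrimes]
    exact nilradical_eq_zero R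
  rwa [h2] at h

theorem isSemisimpleRing_of_nonZeroDivisors_le_isUnit {K : Type*} [CommRing K]
    [IsNoetherianRing K] [IsReduced K] (hK : nonZeroDivisors K ≤ IsUnit.submonoid K) :
    IsSemisimpleRing K := by
  have hdim : Ring.KrullDimLE 0 K := by
    refine Ring.krullDimLE_zero_iff.2 fun I hI => ?_
    obtain ⟨Q, hQ, hIQ⟩ := Ideal.exists_le_maximal I hI.ne_top
    -- `Q` consists of zero divisors, so prime avoidance places it inside a minimal prime
    have hsub : (Q : Set K) ⊆ ⋃ P ∈ minimalPrimes K, (id P : Ideal K) := by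
      intro x hx
      by_contra hne
      refine hQ.ne_top (Q.eq_top_of_isUnit_mem hx (hK (mem_minimalPrimesCompl_iff.1 ?_)))
      exact fun P hP hxP => hne (Set.mem_biUnion hP hxP)
    obtain ⟨P, hP, hQP⟩ := (Ideal.subset_union_prime_finite
      (minimalPrimes.finite_of_isNoetherianRing K) 0 0 fun P hP _ _ => hP.1.1).1 hsub
    have hle : P ≤ I := hP.2 ⟨hI, bot_le⟩ (hIQ.trans hQP)
    have : I = Q := le_antisymm hIQ (hQP.trans hle)
    exact this ▸ hQ
  have : IsArtinianRing K := isArtinianRing_iff_krullDimLE_zero.2 hdim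
  exact IsArtinianRing.isSemisimpleRing_of_isReduced K

/-- Over a reduced Noetherian ring a finite module `N` is generically projective: some
nonzerodivisor times the identity of `N` factors through a finite free module. The total ring of
fractions is semisimple, and a splitting found there needs only finitely many denominators. -/
theorem exists_smul_id_eq_comp {R : Type u} [CommRing R] [IsNoetherianRing R] [IsReduced R]
    (N : Type*) [AddCommGroup N] [Module R N] [Module.Finite R N] :
    ∃ c ∈ nonZeroDivisors R, ∃ (n : ℕ) (π : (Fin n → R) →ₗ[R] N) (σ : N →ₗ[R] (Fin n → R)),
      π ∘ₗ σ = c • LinearMap.id := by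
  obtain ⟨n, π, hπ⟩ := Module.Finite.exists_fin' R N
  let S := nonZeroDivisors R
  have : IsNoetherianRing (Localization S) := IsLocalization.isNoetherianRing S _ inferInstance
  have : IsSemisimpleRing (Localization S) :=
    isSemisimpleRing_of_nonZeroDivisors_le_isUnit
      (IsFractionRing.self_iff_nonZeroDivisors_le_isUnit.1 inferInstance)
  let f := LocalizedModule.mkLinearMap S (Fin n → R)
  let g := LocalizedModule.mkLinearMap S N
  let πS := LocalizedModule.map S π
  have hπS : Function.Surjective πS := IsLocalizedModule.map_surjective S f g π hπ
  obtain ⟨s, hs⟩ := IsSemisimpleModule.lifting_property πS hπS LinearMap.id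
  have := Module.finitePresentation_of_finite R N
  obtain ⟨σ, c, hσ⟩ := Module.FinitePresentation.exists_lift_of_isLocalizedModule S f
    (s.restrictScalars R ∘ₗ g)
  obtain ⟨d, hd⟩ := Module.Finite.exists_smul_of_comp_eq_of_isLocalizedModule S g
    (π ∘ₗ σ) (c • LinearMap.id) (by
      refine LinearMap.ext fun x => ?_
      have h1 : g (π (σ x)) = πS (f (σ x)) := (IsLocalizedModule.map_apply S f g π (σ x)).symm
      have h2 : f (σ x) = (c : R) • s (g x) := LinearMap.congr_fun hσ x
      have h3 : πS (s (g x)) = g x := LinearMap.congr_fun hs (g x)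
      have h4 : πS ((c : R) • s (g x)) = (c : R) • πS (s (g x)) :=
        (πS.restrictScalars R).map_smul _ _
      calc g (π (σ x)) = (c : R) • g x := by rw [h1, h2, h4, h3]
        _ = g ((c • LinearMap.id : N →ₗ[R] N) x) := (map_smul g (c : R) x).symm)
  refine ⟨d * c, mul_mem d.2 c.2, n, π, (d : R) • σ, ?_⟩
  rw [LinearMap.comp_smul, mul_smul]
  exact hd

end Generic

/-! ### Linear maps out of Frobenius twists -/

namespace FrobeniusTwist

variable {R : Type u} [CommRing R] {p : ℕ} [Fact p.Prime] [CharP R p]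

theorem map_of_pow_mul {M : Type*} [AddCommGroup M] [Module R M] {e : ℕ}
    (φ : FrobeniusTwist R p e →ₗ[R] M) (r x : R) :
    φ (of R p e (r ^ p ^ e * x)) = r • φ (of R p e x) := by
  rw [← smul_of, map_smul]

/-- The composite of `ψ : ᵉR → M` with the `e`-th Frobenius twist of `φ : ᵉ'R → R`. -/
def comp {M : Type*} [AddCommGroup M] [Module R M] {e e' : ℕ}
    (ψ : FrobeniusTwist R p e →ₗ[R] M) (φ : FrobeniusTwist R p e' →ₗ[R] R) :
    FrobeniusTwist R p (e + e') →ₗ[R] M where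
  toFun x := ψ (of R p e (φ (of R p e' x)))
  map_add' x y := (congrArg ψ (φ.map_add (of R p e' x) (of R p e' y))).trans (ψ.map_add _ _)
  map_smul' r x := by
    have h : φ (of R p e' (r ^ p ^ (e + e') * (show R from x))) =
        r ^ p ^ e * φ (of R p e' (show R from x)) := by
      rw [pow_add, pow_mul, map_of_pow_mul, smul_eq_mul]
    exact (congrArg (fun z => ψ (of R p e z)) h).trans (map_of_pow_mul ψ _ _)

theorem comp_of {M : Type*} [AddCommGroup M] [Module R M] {e e' : ℕ}
    (ψ : FrobeniusTwist R p e →ₗ[R] M) (φ : FrobeniusTwist R p e' →ₗ[R] R) (x : R) :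
    comp ψ φ (of R p (e + e') x) = ψ (of R p e (φ (of R p e' x))) := rfl

theorem comp_mulLin_of {M : Type*} [AddCommGroup M] [Module R M] {e : ℕ}
    (φ : FrobeniusTwist R p e →ₗ[R] M) (s x : R) :
    (φ ∘ₗ mulLin R p e s) (of R p e x) = φ (of R p e (s * x)) := rfl

/-- The identity of `R`, as a linear map out of `⁰R`. -/
def zeroLin : FrobeniusTwist R p 0 →ₗ[R] R where
  toFun x := x
  map_add' _ _ := rfl
  map_smul' r x := congrArg (· * (show R from x)) ((congrArg (r ^ ·) (pow_zero p)).trans (pow_one r))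

theorem zeroLin_of (x : R) : zeroLin (of R p 0 x) = x := rfl

theorem finite (h : (frobenius R p).Finite) (e : ℕ) : Module.Finite R (FrobeniusTwist R p e) := by
  have h' : (iterateFrobenius R p e).Finite := by
    induction e with
    | zero => rw [iterateFrobenius_zero]; exact RingHom.Finite.id R
    | succ e ih =>
      rw [iterateFrobenius_add, iterateFrobenius_one]
      exact ih.comp h
  exact h'

variable (p) in
/-- `ᵉR` has a finite dual basis up to the scalar `b`: there are `xᵢ ∈ ᵉR` and `fᵢ : ᵉR → R` with
`∑ fᵢ(y) xᵢ = b y`, where the multiplication by `b` is that of the ring `ᵉR`. -/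
def HasDualBasisUpTo (e : ℕ) (b : R) : Prop :=
  ∃ (n : ℕ) (x : Fin n → R) (f : Fin n → FrobeniusTwist R p e →ₗ[R] R),
    ∀ y : R, ∑ i, f i (of R p e y) ^ p ^ e * x i = b * y

theorem HasDualBasisUpTo.mul {e : ℕ} {b : R} (h : HasDualBasisUpTo p e b) (a : R) :
    HasDualBasisUpTo p e (a * b) := by
  obtain ⟨n, x, f, hf⟩ := h
  refine ⟨n, fun i => a * x i, f, fun y => ?_⟩
  rw [mul_assoc, ← hf y, Finset.mul_sum]
  exact Finset.sum_congr rfl fun i _ => mul_left_comm _ _ _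

theorem hasDualBasisUpTo_zero : HasDualBasisUpTo p 0 (1 : R) :=
  ⟨1, fun _ => 1, fun _ => zeroLin, fun y => by simp [zeroLin_of]⟩

theorem HasDualBasisUpTo.succ {e : ℕ} {b b₁ : R} (h : HasDualBasisUpTo p e b)
    (h₁ : HasDualBasisUpTo p 1 b₁) : HasDualBasisUpTo p (e + 1) (b ^ p * b₁) := by
  obtain ⟨n, w, g, hg⟩ := h
  obtain ⟨m, x, f, hf⟩ := h₁
  refine ⟨n * m, fun k => w (finProdFinEquiv.symm k).1 ^ p * x (finProdFinEquiv.symm k).2,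
    fun k => comp (g (finProdFinEquiv.symm k).1) (f (finProdFinEquiv.symm k).2), fun y => ?_⟩
  rw [← finProdFinEquiv.sum_comp, Fintype.sum_prod_type_right]
  simp only [Equiv.symm_apply_apply, comp_of]
  have key : ∀ i, ∑ j, g j (of R p e (f i (of R p 1 y))) ^ p ^ (e + 1) * (w j ^ p * x i) =
      b ^ p * (f i (of R p 1 y) ^ p ^ 1 * x i) := fun i => by
    have h2 := congrArg (fun z => frobenius R p z * x i) (hg (f i (of R p 1 y)))
    simp only [map_sum, Finset.sum_mul, map_mul, map_pow, frobenius_def] at h2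
    rw [pow_one, ← mul_assoc, ← h2]
    refine Finset.sum_congr rfl fun j _ => ?_
    rw [pow_succ, pow_mul, ← mul_assoc, pow_right_comm]
  rw [Finset.sum_congr rfl fun i _ => key i, ← Finset.mul_sum, hf y, mul_assoc]

/-- If `c` times the identity of `¹R` factors through a finite free module then, for every `e`,
so does `c ^ 2` times the identity of `ᵉR`: the exponents of `c` that accumulate in `ᵉR` add up to
`p + ⋯ + p ^ e ≤ 2 p ^ e`. -/
theorem hasDualBasisUpTo_of_one {c : R} (h : HasDualBasisUpTo p 1 (c ^ p)) (e : ℕ) :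
    HasDualBasisUpTo p e ((c ^ 2) ^ p ^ e) := by
  have hp : 2 ≤ p := (Fact.out : p.Prime).two_le
  obtain ⟨k, hk, hb⟩ : ∃ k, k + 2 ≤ 2 * p ^ e ∧ HasDualBasisUpTo p e (c ^ k) := by
    induction e with
    | zero => exact ⟨0, by simp, by simpa using hasDualBasisUpTo_zero⟩
    | succ e ih =>
      obtain ⟨k, hk, hb⟩ := ih
      refine ⟨k * p + p, ?_, ?_⟩
      · rw [pow_succ]
        nlinarith
      · rw [pow_add, pow_mul]
        exact hb.succ h
  have := hb.mul (c ^ (2 * p ^ e - k))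
  rwa [← pow_add, Nat.sub_add_cancel (by omega), pow_mul] at this

theorem exists_hasDualBasisUpTo [IsNoetherianRing R] [IsReduced R]
    (h : (frobenius R p).Finite) :
    ∃ c ∈ nonZeroDivisors R, ∀ e, HasDualBasisUpTo p e (c ^ p ^ e) := by
  have := finite h 1
  obtain ⟨c, hc, n, π, σ, hσ⟩ := exists_smul_id_eq_comp (R := R) (FrobeniusTwist R p 1)
  refine ⟨c ^ 2, pow_mem hc 2, hasDualBasisUpTo_of_one ⟨n, fun i => π (Pi.single i 1),
    fun i => LinearMap.proj i ∘ₗ σ, fun y => ?_⟩⟩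
  have h1 : π (σ (of R p 1 y)) = c ^ p ^ 1 * y := LinearMap.congr_fun hσ (of R p 1 y)
  have h2 : σ (of R p 1 y) = ∑ i, σ (of R p 1 y) i • Pi.single i 1 :=
    pi_eq_sum_univ' _
  rw [h2, map_sum] at h1
  rw [show c ^ p = c ^ p ^ 1 by rw [pow_one]]
  exact (Finset.sum_congr rfl fun i _ => (map_smul π _ _).symm).trans h1

end FrobeniusTwist

/-! ### Test elements -/

section TestElement

variable {R : Type u} [CommRing R] {p : ℕ} [Fact p.Prime] [CharP R p]

open FrobeniusTwist

variable (p) in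
/-- The ideal of values at `ᵉd` of the linear maps `ᵉR → R`. If `ᵉR` is projective, it is the
smallest ideal whose `e`-th Frobenius power contains `d`. -/
def valueIdeal (d : R) (e : ℕ) : Ideal R :=
  LinearMap.range (LinearMap.applyₗ (of R p e d) : (FrobeniusTwist R p e →ₗ[R] R) →ₗ[R] R)

theorem apply_mem_valueIdeal {d : R} {e : ℕ} (φ : FrobeniusTwist R p e →ₗ[R] R) :
    φ (of R p e d) ∈ valueIdeal p d e := ⟨φ, rfl⟩

/-- The value ideals increase with `e`, up to a power of `c`. -/
theorem pow_mul_mem_valueIdeal_succ {c d r : R} {e : ℕ}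
    (hc : HasDualBasisUpTo p (e + 1) (c ^ p ^ (e + 1))) (hr : r ∈ valueIdeal p d e) :
    c ^ p * r ∈ valueIdeal p d (e + 1) := by
  obtain ⟨φ, rfl⟩ := hr
  obtain ⟨n, x, f, hf⟩ := hc
  have hp : 0 < p := (Fact.out : p.Prime).pos
  have hz : c ^ p * φ (of R p e d) =
      ∑ i, f i (of R p (e + 1) d) ^ p * φ (of R p e (x i)) := by
    rw [← smul_eq_mul, ← map_of_pow_mul, ← pow_mul, ← pow_succ', ← hf d]
    refine (map_sum φ (fun i => of R p e (f i (of R p (e + 1) d) ^ p ^ (e + 1) * x i)) _).trans ?_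
    refine Finset.sum_congr rfl fun i _ => ?_
    rw [pow_succ', pow_mul, map_of_pow_mul, smul_eq_mul]
  change c ^ p * φ (of R p e d) ∈ _
  rw [hz]
  exact Ideal.sum_mem _ fun i _ => Ideal.mul_mem_right _ _
    (Ideal.pow_mem_of_mem _ (apply_mem_valueIdeal _) _ hp)

/-- The elementary form of strong `F`-regularity of `R_c`. In `R_c` the ideals of values at `ᵉd`
stabilize to an ideal `J` with `d ∈ J ^ n` for all `n`. By Krull's intersection theorem `J` is the
unit ideal, as `d` is a nonzerodivisor. -/
theorem exists_pow_mem_valueIdeal [IsNoetherianRing R] {c d : R}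
    (hc : ∀ e, HasDualBasisUpTo p e (c ^ p ^ e)) (hd : d ∈ nonZeroDivisors R) (n₀ : ℕ) :
    ∃ e, n₀ ≤ e ∧ ∃ k, c ^ k ∈ valueIdeal p d e := by
  have hp : 1 < p := (Fact.out : p.Prime).one_lt
  let A := Localization.Away c
  have : IsNoetherianRing A := IsLocalization.isNoetherianRing (Submonoid.powers c) A inferInstance
  have hcu : IsUnit (algebraMap R A c) := IsLocalization.Away.algebraMap_isUnit c
  have hmem : ∀ (I : Ideal R) (k : ℕ) (r : R), c ^ k * r ∈ I →
      algebraMap R A r ∈ I.map (algebraMap R A) := fun I k r h => by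
    have h1 := Ideal.mem_map_of_mem (algebraMap R A) h
    rwa [map_mul, map_pow, Ideal.unit_mul_mem_iff_mem _ (hcu.pow k)] at h1
  let J : ℕ →o Ideal A := ⟨fun e => (valueIdeal p d e).map (algebraMap R A),
    monotone_nat_of_le_succ fun e => Ideal.map_le_iff_le_comap.2 fun r hr =>
      hmem _ p r (pow_mul_mem_valueIdeal_succ (hc (e + 1)) hr)⟩
  obtain ⟨e₀, he₀⟩ := monotone_stabilizes_iff_noetherian.2 this J
  have hJ : ∀ n, algebraMap R A d ∈ J e₀ ^ n := fun n => by
    obtain ⟨m, x, f, hf⟩ := hc (max n e₀)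
    have hq : n ≤ p ^ max n e₀ := (le_max_left n e₀).trans (Nat.lt_pow_self hp).le
    have h1 : c ^ p ^ max n e₀ * d ∈ valueIdeal p d (max n e₀) ^ n := by
      rw [← hf d]
      exact Ideal.sum_mem _ fun i _ => Ideal.mul_mem_right _ _
        (Ideal.pow_le_pow_right hq (Ideal.pow_mem_pow (apply_mem_valueIdeal _) _))
    have h2 := hmem _ _ _ h1
    rw [Ideal.map_pow] at h2
    rwa [he₀ _ (le_max_right n e₀)]
  obtain ⟨⟨r, hrJ⟩, hr⟩ := (Ideal.mem_iInf_smul_pow_eq_bot_iff (J e₀) (algebraMap R A d)).1 (by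
    simpa only [Submodule.mem_iInf, smul_eq_mul, Ideal.mul_top] using hJ)
  have hd' : algebraMap R A d ∈ nonZeroDivisors A :=
    IsLocalization.map_nonZeroDivisors_le (Submonoid.powers c) A
      (Submonoid.mem_map_of_mem (algebraMap R A) hd)
  have hr1 : r = 1 := by
    have : (r - 1) * algebraMap R A d = 0 := by
      rw [sub_mul, one_mul, sub_eq_zero]
      exact hr
    exact sub_eq_zero.1 ((mem_nonZeroDivisors_iff_right.1 hd') _ this)
  subst hr1
  refine ⟨max n₀ e₀, le_max_left _ _, ?_⟩
  have h1 : algebraMap R A 1 ∈ (valueIdeal p d (max n₀ e₀)).map (algebraMap R A) := by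
    rw [map_one]
    have := he₀ _ (le_max_right n₀ e₀)
    change J e₀ = (valueIdeal p d (max n₀ e₀)).map (algebraMap R A) at this
    rwa [← this]
  obtain ⟨_, ⟨k, rfl⟩, hk⟩ :=
    (IsLocalization.algebraMap_mem_map_algebraMap_iff (Submonoid.powers c) A _ _).1 h1
  exact ⟨k, by simpa using hk⟩

/-- A splitting-type map `φ : ᵉR → R` with `φ(ᵉ1) = t`, where `e > 0`, can be iterated at the cost
of replacing `t` by `t ^ 2` only, since `φ(ᵉ(t ^ p ^ e)) = t ^ 2`. -/
theorem sq_mem_valueIdeal_one {t : R} {e : ℕ} (he : 0 < e) (ht : t ∈ valueIdeal p 1 e) (n : ℕ) :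
    ∃ m, n ≤ m ∧ t ^ 2 ∈ valueIdeal p 1 m := by
  obtain ⟨φ, hφ⟩ := ht
  have hφ : φ (of R p e 1) = t := hφ
  induction n with
  | zero => exact ⟨e, Nat.zero_le _, by
      rw [pow_two]; exact Ideal.mul_mem_left _ _ (hφ ▸ apply_mem_valueIdeal φ)⟩
  | succ n ih =>
    obtain ⟨m, hm, ψ, hψ⟩ := ih
    have hψ : ψ (of R p m 1) = t ^ 2 := hψ
    have hq : 2 ≤ p ^ e := (Fact.out : p.Prime).two_le.trans (Nat.le_self_pow he.ne' p)
    refine ⟨e + m, by omega, ?_⟩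
    have h := apply_mem_valueIdeal (d := (1 : R)) (comp (φ ∘ₗ mulLin R p e (t ^ (p ^ e - 2))) ψ)
    rwa [comp_of, comp_mulLin_of, hψ, ← pow_add, Nat.sub_add_cancel hq, ← mul_one (t ^ p ^ e),
      map_of_pow_mul, hφ, smul_eq_mul, ← pow_two] at h

/-- Existence of a test element: one `t ∈ R°` is a value at `ᵉd` of a map `ᵉR → R`, for every
`d ∈ R°` and arbitrarily large `e`. -/
theorem exists_testElement [IsNoetherianRing R] [IsReduced R] (h : (frobenius R p).Finite) :
    ∃ t ∈ minimalPrimesCompl R, ∀ d ∈ minimalPrimesCompl R, ∀ n, ∃ e, n ≤ e ∧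
      t ∈ valueIdeal p d e := by
  obtain ⟨c, hc, hb⟩ := exists_hasDualBasisUpTo h
  have hp : 1 < p := (Fact.out : p.Prime).one_lt
  obtain ⟨e₁, he₁, N, hN⟩ := exists_pow_mem_valueIdeal hb (one_mem _) 1
  refine ⟨c * (c ^ N) ^ 2, mem_minimalPrimesCompl_iff.2
    (mul_mem hc (pow_mem (pow_mem hc N) 2)), fun d hd n => ?_⟩
  obtain ⟨e, he, k, φ, hφ⟩ := exists_pow_mem_valueIdeal hb (mem_minimalPrimesCompl_iff.1 hd) n
  have hφ : φ (of R p e d) = c ^ k := hφ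
  -- the exponent `k` depends on `d`, and is absorbed by a map `ψ` of large level `m`
  obtain ⟨m, hm, ψ, hψ⟩ := sq_mem_valueIdeal_one he₁ hN k
  have hψ : ψ (of R p m 1) = (c ^ N) ^ 2 := hψ
  have hq : k ≤ p ^ m := hm.trans (Nat.lt_pow_self hp).le
  refine ⟨m + e, by omega, ?_⟩
  have h := apply_mem_valueIdeal (d := d) (comp (ψ ∘ₗ mulLin R p m (c ^ (p ^ m - k))) φ)
  rwa [comp_of, comp_mulLin_of, hφ, ← pow_add, Nat.sub_add_cancel hq, ← mul_one (c ^ p ^ m),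
    map_of_pow_mul, hψ, smul_eq_mul] at h

/-- For a test element `t`, the single submodule `tightInteriorAt R p M t 0` is already the tight
interior. -/
theorem exists_tightInteriorAt_le [IsNoetherianRing R] [IsReduced R]
    (h : (frobenius R p).Finite) :
    ∃ t ∈ minimalPrimesCompl R, ∀ (M : Type w) [AddCommGroup M] [Module R M],
      tightInteriorAt R p M t 0 ≤ tightInterior R p M := by
  obtain ⟨t, ht, htest⟩ := exists_testElement h
  refine ⟨t, ht, fun M _ _ => tightInteriorAt_le_iff.2 fun e _ g => ?_⟩
  refine mem_tightInterior.2 fun d hd e₀ => ?_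
  obtain ⟨e', he', φ, hφ⟩ := htest d hd e₀
  have h := apply_mem_tightInteriorAt (c := d) (he'.trans (Nat.le_add_left e' e)) (comp g φ)
  have hφ : φ (of R p e' d) = t := hφ
  rwa [comp_of, hφ] at h

end TestElement

/-! ### Duality over an `F`-finite ring -/

section FFinite

variable {R : Type u} [CommRing R] {E : Type (max u v)} [AddCommGroup E] [Module R E]

/-- The elementwise form of the injectivity of `N ⊗ Hom(M, E) → Hom(Hom(N, M), E)`, for `N`
finitely presented and `E` injective. -/
theorem tmul_eq_zero_of_forall_apply_eq_zero (hE : Module.Injective R E)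
    {M N : Type*} [AddCommGroup M] [Module R M] [AddCommGroup N] [Module R N]
    [Module.FinitePresentation R N] {y : N} {f : M →ₗ[R] E}
    (h : ∀ g : N →ₗ[R] M, f (g y) = 0) : y ⊗ₜ[R] f = (0 : N ⊗[R] (M →ₗ[R] E)) := by
  obtain ⟨n, m, π, ρ, hπ, hex⟩ := Module.FinitePresentation.exists_fin' R N
  obtain ⟨a, rfl⟩ := hπ y
  -- evaluation at `a` followed by `f` kills the maps that descend to `N`, so it factors
  -- through restriction along `ρ`
  obtain ⟨H, hH⟩ := hE.exists_comp_eq_of_ker_le (LinearMap.lcomp R M ρ)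
    (f ∘ₗ LinearMap.applyₗ a) (by
      intro u hu
      have hu' : ∀ v, u (ρ v) = 0 := fun v => LinearMap.congr_fun hu v
      have hle : LinearMap.ker π ≤ LinearMap.ker u := fun v hv => by
        obtain ⟨w, rfl⟩ := (hex v).1 hv
        exact hu' w
      obtain ⟨g, hg⟩ : ∃ g : N →ₗ[R] M, g ∘ₗ π = u :=
        ⟨(LinearMap.ker π).liftQ u hle ∘ₗ (π.quotKerEquivOfSurjective hπ).symm.toLinearMap,
          LinearMap.ext fun v => by
            have : (π.quotKerEquivOfSurjective hπ).symm (π v) = Submodule.Quotient.mk v :=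
              (LinearEquiv.symm_apply_eq _).2 rfl
            rw [LinearMap.comp_apply, LinearMap.comp_apply, LinearEquiv.coe_coe, this,
              Submodule.liftQ_apply]⟩
      subst hg
      exact h g)
  let δ : ∀ k, Fin k → M →ₗ[R] ((Fin k → R) →ₗ[R] M) := fun k i =>
    LinearMap.lcomp R M (LinearMap.proj i) ∘ₗ (LinearMap.lsmul R M).flip
  have hδ : ∀ k i x v, δ k i x v = v i • x := fun k i x v => rfl
  have hcoef : ∀ i, a i • f = ∑ j, ρ (Pi.single j 1) i • (H ∘ₗ δ m j) := fun i => by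
    refine LinearMap.ext fun x => ?_
    have h1 := LinearMap.congr_fun hH (δ n i x)
    have h2 : LinearMap.lcomp R M ρ (δ n i x) = ∑ j, ρ (Pi.single j 1) i • δ m j x := by
      refine LinearMap.pi_ext' fun j => LinearMap.ext_ring ?_
      simp [hδ, Pi.single_apply]
    rw [LinearMap.comp_apply, h2, map_sum] at h1
    simp only [map_smul] at h1
    rw [LinearMap.sum_apply, LinearMap.smul_apply, ← map_smul]
    exact h1.symm
  have hsum : ∀ (k : ℕ) (v : Fin k → R), v = ∑ i, v i • Pi.single i 1 := fun k v =>
    pi_eq_sum_univ' v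
  calc π a ⊗ₜ[R] f = ∑ i, π (Pi.single i 1) ⊗ₜ[R] (a i • f) := by
        conv_lhs => rw [hsum n a, map_sum, TensorProduct.sum_tmul]
        simp only [map_smul, TensorProduct.smul_tmul]
    _ = ∑ j, π (ρ (Pi.single j 1)) ⊗ₜ[R] (H ∘ₗ δ m j) := by
        simp only [hcoef, TensorProduct.tmul_sum]
        rw [Finset.sum_comm]
        refine Finset.sum_congr rfl fun j _ => ?_
        conv_rhs => rw [hsum n (ρ _), map_sum, TensorProduct.sum_tmul]
        simp only [map_smul, TensorProduct.smul_tmul]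
    _ = 0 := Finset.sum_eq_zero fun j _ => by
        rw [(hex _).2 ⟨_, rfl⟩, TensorProduct.zero_tmul]

theorem mem_zeroTightClosure_dual_iff_of_finite [IsNoetherianRing R] [IsReduced R]
    {p : ℕ} [Fact p.Prime] [CharP R p] (h : (frobenius R p).Finite)
    (hE : Module.Injective R E) {M : Type w} [AddCommGroup M] [Module R M] (f : M →ₗ[R] E) :
    f ∈ zeroTightClosure R p (M →ₗ[R] E) ↔ ∀ x ∈ tightInterior R p M, f x = 0 := by
  constructor
  · rintro ⟨c, hc, e₀, hf⟩ x hx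
    have hle : tightInteriorAt R p M c e₀ ≤ LinearMap.ker f :=
      tightInteriorAt_le_iff.2 fun e he g => by
        have h1 := congrArg (TensorProduct.lift
          ((LinearMap.llcomp R (FrobeniusTwist R p e) M E).flip g).flip) (hf e he)
        rwa [TensorProduct.lift.tmul, map_zero] at h1
    exact hle (mem_tightInterior.1 hx c hc e₀)
  · intro hf
    obtain ⟨t, ht, htM⟩ := exists_tightInteriorAt_le.{u, w} h
    refine ⟨t, ht, 0, fun e he => ?_⟩
    have := FrobeniusTwist.finite h e
    have := Module.finitePresentation_of_finite R (FrobeniusTwist R p e)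
    exact tmul_eq_zero_of_forall_apply_eq_zero hE fun g =>
      hf _ (htM M (apply_mem_tightInteriorAt he g))

end FFinite

/-! ### Tight interior and tight closure of zero under duality -/

theorem mainTheorem9 (p : ℕ) [Fact p.Prime] (R : Type u) [CommRing R] [IsNoetherianRing R]
    [IsReduced R] [CharP R p] :
    ((frobenius R p).Finite →
      ∀ (E : Type (max u v)) [AddCommGroup E] [Module R E], Module.Injective R E →
      ∀ (M : Type w) [AddCommGroup M] [Module R M],
        ∃ φ : ((M →ₗ[R] E) ⧸ zeroTightClosure R p (M →ₗ[R] E)) ≃ₗ[R]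
            (tightInterior R p M →ₗ[R] E),
          ∀ (f : M →ₗ[R] E) (x : tightInterior R p M), φ (Submodule.Quotient.mk f) x = f x) ∧
    (∀ [IsLocalRing R], IsAdicComplete (IsLocalRing.maximalIdeal R) R →
      ∀ (E : Type (max u v)) [AddCommGroup E] [Module R E],
        IsInjectiveHull R (IsLocalRing.ResidueField R) E →
      ∀ (L : Type w) [AddCommGroup L] [Module R L],
        (IsArtinian R L ∨ Module.Finite R L ∨ IsDualizable R E L) →
        (∃ φ : ((L →ₗ[R] E) ⧸ zeroTightClosure R p (L →ₗ[R] E)) ≃ₗ[R]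
            (tightInterior R p L →ₗ[R] E),
          ∀ (f : L →ₗ[R] E) (x : tightInterior R p L), φ (Submodule.Quotient.mk f) x = f x) ∧
        (∃ ψ : tightInterior R p (L →ₗ[R] E) ≃ₗ[R] ((L ⧸ zeroTightClosure R p L) →ₗ[R] E),
          ∀ (g : tightInterior R p (L →ₗ[R] E)) (x : L),
            ψ g (Submodule.Quotient.mk x) = (g : L →ₗ[R] E) x)) := by
  refine ⟨fun hF E _ _ hE M _ _ => exists_quotient_zeroTightClosure_equiv hE
    (mem_zeroTightClosure_dual_iff_of_finite hF hE), ?_⟩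
  intro _ hcomplete E _ _ hE L _ _ hL
  have hdual : IsDualizable R E L := by
    rcases hL with hL | hL | hL
    · exact hE.isDualizable_of_isArtinian
    · exact hE.isDualizable_of_finite
    · exact hL
  exact ⟨exists_quotient_zeroTightClosure_equiv hE.1 (hdual.mem_zeroTightClosure_dual_iff hE),
    hdual.exists_tightInterior_dual_equiv hE⟩
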